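/- Let $\mathfrak{L}$ be the set of all linear operators $T:\mathbb{R}[x]\to\mathbb{R}[x]$ and $D=\frac{d}{dx}$. Let $$POS=\{p\in\mathbb{R}[x]: p(x)>0 \text{ for all } x\in\mathbb{R}\},\quad ELL=\{p\in\mathbb{R}[x]: p(x)\neq 0\text{ for all }x\in\mathbb{R}\},$$ let $SOS$ be the set of all finite sums of squares of polynomials in $\mathbb{R}[x]$, and for $V\in\{POS,SOS,ELL\}$ and $\ell\in\mathbb{N}_0$ put $V_\ell=\{p\in V:\deg p\le \ell\}$ and $\mathfrak{L}(V)=\{T\in\mathfrak{L}: T(V)\subseteq V\}$. An element of order $d$ of the Weyl algebra $\mathcal{A}_1(\mathbb{R})$ is an operator $T=\sum_{i=0}^{d}q_i(x)D^i$ with $q_i\in\mathbb{R}[x]$ and $q_d\neq 0$. An operator with constant coefficients is an operator $T=\sum_{i=0}^{\infty}a_iD^i$ with $a_i\in\mathbb{R}$, of finite or infinite order. Then: (a) If $T$ is an element of $\mathcal{A}_1(\mathbb{R})$ of order $d\ge 1$, then $T(V_\ell)\setminus V\neq\emptyset$ for every even integer $\ell>d$ and every $V\in\{POS,SOS,ELL\}$.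 (b) No linear ordinary differential operator with polynomial coefficients of finite positive order belongs to $\mathfrak{L}(POS)\cup\mathfrak{L}(SOS)\cup\mathfrak{L}(ELL)$. (c) Let $T\in\mathfrak{L}\setminus\{0\}$ be an operator with constant coefficients. Then $$T\in\mathfrak{L}(POS)\iff T\in\mathfrak{L}(SOS)\iff T(f)(x)=\int f(t+x)\,d\mu(t)\ \text{ for all } f\in\mathbb{R}[x],\ x\in\mathbb{R},$$ for some non-negative Borel measure $\mu$ on $\mathbb{R}$ with $\int|t^m|\,d\mu(t)<\infty$ for all $m\in\mathbb{N}_0$. Moreover, $T\in\mathfrak{L}(ELL)$ if and only if $T\in\mathfrak{L}(POS)$ or $-T\in\mathfrak{L}(POS)$. -/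

import Mathlib

open Polynomial MeasureTheory

/-- The positive polynomials. -/
def POS : Set ℝ[X] := {p | ∀ x : ℝ, 0 < p.eval x}

/-- The finite sums of squares of polynomials. -/
def SOS : Set ℝ[X] := {p | IsSumSq p}

/-- The elliptic polynomials, i.e. those without real zeros. -/
def ELL : Set ℝ[X] := {p | ∀ x : ℝ, p.eval x ≠ 0}

/-- The part `V_ℓ` of `V` consisting of the polynomials of degree at most `ℓ`. -/
def degreePart (V : Set ℝ[X]) (ℓ : ℕ) : Set ℝ[X] := V ∩ {p | p.natDegree ≤ ℓ}

/-- The set `𝔏(V)` of all linear operators `T` on `ℝ[X]` with `T(V) ⊆ V`. -/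
def preservers (V : Set ℝ[X]) : Set (ℝ[X] →ₗ[ℝ] ℝ[X]) := {T | T '' V ⊆ V}

/-- `T = ∑_{i ≥ 0} q_i(x) D^i`. The sum is possibly infinite, but applied to a polynomial `f`
its terms of index `i > natDegree f` vanish, so they are left out. -/
def IsDiffSeries (T : ℝ[X] →ₗ[ℝ] ℝ[X]) (q : ℕ → ℝ[X]) : Prop :=
  ∀ f : ℝ[X], T f = ∑ i ∈ Finset.range (f.natDegree + 1), q i * derivative^[i] f

/-- `T` is an element of order exactly `d` of the Weyl algebra of the real line: a linear ordinary
differential operator `∑_{i=0}^d q_i(x) D^i` with polynomial coefficients and `q_d ≠ 0`. -/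
def IsWeylOfOrder (T : ℝ[X] →ₗ[ℝ] ℝ[X]) (d : ℕ) : Prop :=
  ∃ q : ℕ → ℝ[X], IsDiffSeries T q ∧ q d ≠ 0 ∧ ∀ i, d < i → q i = 0

/-- `T` is a linear ordinary differential operator `∑_{i ≥ 0} a_i D^i` with constant
coefficients, of finite or infinite order. -/
def IsConstCoeff (T : ℝ[X] →ₗ[ℝ] ℝ[X]) : Prop :=
  ∃ a : ℕ → ℝ, IsDiffSeries T (fun i => C (a i))

/-- A (non-negative, Borel) measure on the real line all of whose moments are finite. -/
def HasFiniteMoments (μ : Measure ℝ) : Prop :=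
  ∀ m : ℕ, Integrable (fun t : ℝ => t ^ m) μ

/-- `T` is the convolution `T(f)(x) = ∫ f(t + x) dμ(t)` with a non-negative measure on the real
line that has finite moments of all orders. -/
def IsMomentConvolution (T : ℝ[X] →ₗ[ℝ] ℝ[X]) : Prop :=
  ∃ μ : Measure ℝ, HasFiniteMoments μ ∧
    ∀ (f : ℝ[X]) (x : ℝ), (T f).eval x = ∫ t, f.eval (t + x) ∂μ

/-! Everything reduces to functionals `p ↦ (T p)(y)`. For order `d ≥ 1`, choose `y` with `q_d(y) ≠
0`: the functional kills high powers of `X - y` but not `(X - y)^d`, so perturbing a killed even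
power by a cross term gives positive polynomials with values of either sign
(`IsWeylOfOrder.exists_eval_pos_and_neg`). A positive combination of two of these has value zero,
which settles `ELL`. Constant coefficients make `T` commute with translations, so the functional at
`0` determines `T`; positivity on non-negative polynomials, which are the sums of squares, yields
the measure by Haviland's theorem (`exists_measure_of_nonneg`). -/

/-! ### Non-negative polynomials and sums of squares -/

theorem exists_forall_eval_le_of_nonneg {p : ℝ[X]} (hp : ∀ x, 0 ≤ p.eval x) :
    ∃ a, ∀ x, p.eval a ≤ p.eval x := by
  by_cases hd : p.degree ≤ 0
  · rw [eq_C_of_degree_le_zero hd]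
    exact ⟨0, fun x => by simp⟩
  · refine p.continuous.exists_forall_le ?_
    have h := p.tendsto_norm_atTop (not_le.mp hd) (z := fun x : ℝ => x)
      (tendsto_norm_cocompact_atTop (E := ℝ))
    exact h.congr fun x => by rw [Real.norm_eq_abs, abs_of_nonneg (hp x)]

/-- With `m` the minimum, attained at `a`, `p - m` has a root of order at least two at `a`. Hence `p
= (X - a)^2 q + m` with `q` non-negative of smaller degree. -/
theorem isSumSq_of_eval_nonneg {p : ℝ[X]} (hp : ∀ x, 0 ≤ p.eval x) : IsSumSq p := by
  induction h : p.natDegree using Nat.strong_induction_on generalizing p with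
  | _ n ih =>
  obtain ⟨a, ha⟩ := exists_forall_eval_le_of_nonneg hp
  set m := p.eval a with hm
  have hCm : IsSumSq (C m) := by
    have := IsSumSq.mul_self (C (√m))
    rwa [← C_mul, Real.mul_self_sqrt (hp a)] at this
  by_cases h0 : p - C m = 0
  · rw [sub_eq_zero.mp h0]; exact hCm
  have hroot : (p - C m).IsRoot a := by simp [m]
  have hder : (derivative (p - C m)).IsRoot a := by
    have : deriv (fun x => p.eval x) a = 0 :=
      IsLocalMin.deriv_eq_zero (Filter.Eventually.of_forall ha)
    simpa using this
  have hmult := (one_lt_rootMultiplicity_iff_isRoot h0).2 ⟨hroot, hder⟩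
  obtain ⟨q, hq⟩ := (pow_dvd_pow (X - C a) hmult).trans (pow_rootMultiplicity_dvd _ a)
  have hq0 : q ≠ 0 := by rintro rfl; simp at hq; exact h0 hq
  have hpq : p = (X - C a) ^ 2 * q + C m := by rw [← sub_eq_iff_eq_add]; exact hq
  have hdeg : q.natDegree < n := by
    have h1 : (p - C m).natDegree = n := by rw [natDegree_sub_C, h]
    rw [hq, natDegree_mul (pow_ne_zero _ (X_sub_C_ne_zero a)) hq0, natDegree_pow,
      natDegree_X_sub_C] at h1
    omega
  have hqn : ∀ x, 0 ≤ q.eval x := by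
    have hne : ∀ x ∈ ({a}ᶜ : Set ℝ), q.eval x ∈ Set.Ici (0 : ℝ) := by
      intro x hx
      have h1 : p.eval x = (x - a) ^ 2 * q.eval x + m := by
        conv_lhs => rw [hpq]
        simp
      have h2 : 0 < (x - a) ^ 2 := by
        have : x - a ≠ 0 := sub_ne_zero.mpr hx
        positivity
      have h3 := ha x
      exact nonneg_of_mul_nonneg_right (by linarith) h2
    intro x
    have hx : x ∈ closure ({a}ᶜ : Set ℝ) := by
      rw [(dense_compl_singleton a).closure_eq]; trivial
    have := map_mem_closure q.continuous hx hne
    rwa [isClosed_Ici.closure_eq] at this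
  rw [hpq]
  refine IsSumSq.add (IsSumSq.mul ?_ (ih _ hdeg hqn rfl)) hCm
  rw [sq]
  exact IsSumSq.mul_self _

theorem IsSumSq.eval_nonneg {p : ℝ[X]} (hp : IsSumSq p) (x : ℝ) : 0 ≤ p.eval x := by
  induction hp with
  | zero => simp
  | sq_add a _ ih =>
    rw [eval_add, eval_mul]
    exact add_nonneg (mul_self_nonneg _) ih

theorem mem_SOS_iff {p : ℝ[X]} : p ∈ SOS ↔ ∀ x, 0 ≤ p.eval x :=
  ⟨IsSumSq.eval_nonneg, isSumSq_of_eval_nonneg⟩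

/-! ### Operators of finite positive order -/

theorem IsDiffSeries.eval_X_sub_C_pow {T : ℝ[X] →ₗ[ℝ] ℝ[X]} {q : ℕ → ℝ[X]}
    (hT : IsDiffSeries T q) (y : ℝ) (n : ℕ) :
    (T ((X - C y) ^ n)).eval y = n.factorial * (q n).eval y := by
  rw [hT, natDegree_pow, natDegree_X_sub_C, mul_one, eval_finsetSum,
    Finset.sum_range_succ, Finset.sum_eq_zero, zero_add, eval_mul,
    iterate_derivative_X_sub_pow_self, eval_natCast, mul_comm]
  intro i hi
  have hi : n - i ≠ 0 := by have := Finset.mem_range.1 hi; omega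
  rw [eval_mul, iterate_derivative_X_sub_pow]
  simp [hi]

/-- A polynomial differential operator of order `d` takes both signs at a suitable point on the
strictly positive polynomials of even degree slightly above `d`. -/
theorem IsWeylOfOrder.exists_eval_pos_and_neg {T : ℝ[X] →ₗ[ℝ] ℝ[X]} {d : ℕ} (hd : 1 ≤ d)
    (hT : IsWeylOfOrder T d) {ℓ : ℕ} (hℓ : Even ℓ) (hdℓ : d < ℓ) :
    ∃ (y : ℝ) (p₁ p₂ : ℝ[X]), p₁ ∈ POS ∧ p₂ ∈ POS ∧ IsSumSq p₁ ∧ p₁.natDegree ≤ ℓ ∧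
      p₂.natDegree ≤ ℓ ∧ (T p₁).eval y < 0 ∧ 0 < (T p₂).eval y := by
  obtain ⟨q, hq, hqd, hqi⟩ := hT
  obtain ⟨y, hy⟩ : ∃ y, (q d).eval y ≠ 0 := by
    by_contra! h
    exact hqd (Polynomial.funext fun x => by simpa using h x)
  -- `2k` is the least even number above `d`; `k ≤ d` makes `d - k` a true difference.
  obtain ⟨k, hk1, hk2, hk3⟩ : ∃ k, d < 2 * k ∧ k ≤ d ∧ 2 * k ≤ ℓ := by
    obtain ⟨m, rfl⟩ := hℓ
    exact ⟨d / 2 + 1, by omega, by omega, by omega⟩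
  set α := (T ((X - C y) ^ d)).eval y with hα
  set β := (T ((X - C y) ^ (2 * (d - k)))).eval y with hβ
  have hα0 : α ≠ 0 := by
    rw [hα, hq.eval_X_sub_C_pow]
    exact mul_ne_zero (by exact_mod_cast d.factorial_ne_zero) hy
  have hk0 : (T ((X - C y) ^ (2 * k))).eval y = 0 := by
    rw [hq.eval_X_sub_C_pow, hqi _ hk1, eval_zero, mul_zero]
  set γ := (T 1).eval y with hγ
  let P : ℝ → ℝ → ℝ[X] := fun c e =>
    ((X - C y) ^ k + C c * (X - C y) ^ (d - k)) * ((X - C y) ^ k + C c * (X - C y) ^ (d - k)) +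
      C e * C e
  have hPsos : ∀ c e, IsSumSq (P c e) := fun c e =>
    (IsSumSq.mul_self _).add (IsSumSq.mul_self _)
  have hPpos : ∀ c e, e ≠ 0 → P c e ∈ POS := by
    intro c e he x
    have : 0 < e * e := mul_self_pos.mpr he
    simp only [P, eval_add, eval_mul, eval_C]
    nlinarith [mul_self_nonneg
      (eval x ((X - C y) ^ k) + c * eval x ((X - C y) ^ (d - k)))]
  have hPdeg : ∀ c e, (P c e).natDegree ≤ ℓ := by
    intro c e
    have h1 : ((X - C y) ^ k + C c * (X - C y) ^ (d - k)).natDegree ≤ k := by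
      refine natDegree_add_le_of_degree_le ?_ ?_
      · rw [natDegree_pow, natDegree_X_sub_C, mul_one]
      · refine (natDegree_C_mul_le _ _).trans ?_
        rw [natDegree_pow, natDegree_X_sub_C, mul_one]
        omega
    refine natDegree_add_le_of_degree_le ?_ ?_
    · exact natDegree_mul_le.trans (by omega)
    · rw [← C_mul, natDegree_C]; omega
  have hPeval : ∀ c e, (T (P c e)).eval y = 2 * c * α + c ^ 2 * β + e ^ 2 * γ := by
    intro c e
    have : P c e = (X - C y) ^ (2 * k) + (2 * c) • (X - C y) ^ d +
        (c ^ 2) • (X - C y) ^ (2 * (d - k)) + (e ^ 2) • (1 : ℝ[X]) := by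
      have hdk : (X - C y) ^ d = (X - C y) ^ k * (X - C y) ^ (d - k) := by
        rw [← pow_add]; congr 1; omega
      simp only [smul_eq_C_mul, P, hdk, C_mul, C_pow, pow_mul']
      simp only [map_ofNat]
      ring
    rw [this]
    simp only [map_add, map_smul, eval_add, eval_smul, smul_eq_mul, hk0, ← hα, ← hβ, ← hγ]
    ring
  -- For `c = ∓tα` and `e = tα` the value is `tα²(∓2 + t(β + γ))`, where small `t` lets `∓2` decide
  -- the sign.
  obtain ⟨s, e, hs, he, h1, h2⟩ : ∃ s e : ℝ, s ≠ 0 ∧ e ≠ 0 ∧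
      2 * s * α + s ^ 2 * β + e ^ 2 * γ < 0 ∧ 0 < 2 * (-s) * α + (-s) ^ 2 * β + e ^ 2 * γ := by
    have hden : 0 < 1 + |β| + |γ| := by positivity
    set t := 1 / (1 + |β| + |γ|) with ht
    have ht0 : 0 < t := by positivity
    have ht1 : t * (|β| + |γ|) < 1 := by
      rw [ht, div_mul_eq_mul_div, div_lt_one hden]; linarith
    refine ⟨-(t * α), t * α, by simp [hα0, ht0.ne'], by simp [hα0, ht0.ne'], ?_, ?_⟩
    · have hA : 0 < t * α ^ 2 := by positivity
      have : t * (β + γ) < 1 := lt_of_le_of_lt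
        (mul_le_mul_of_nonneg_left (add_le_add (le_abs_self _) (le_abs_self _)) ht0.le) ht1
      nlinarith
    · have hA : 0 < t * α ^ 2 := by positivity
      have : -1 < t * (β + γ) := by
        have := mul_le_mul_of_nonneg_left
          (add_le_add (neg_abs_le β) (neg_abs_le γ)) ht0.le
        nlinarith
      nlinarith
  exact ⟨y, P s e, P (-s) e, hPpos _ _ he, hPpos _ _ he, hPsos _ _, hPdeg _ _, hPdeg _ _,
    by rw [hPeval]; exact h1, by rw [hPeval]; exact h2⟩

/-- If a functional of the form `p ↦ (T p)(y)` is negative at one strictly positive polynomial and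
positive at another, then it vanishes at a convex combination, which is again positive. -/
theorem exists_mem_POS_eval_eq_zero {T : ℝ[X] →ₗ[ℝ] ℝ[X]} {y : ℝ} {p₁ p₂ : ℝ[X]} {ℓ : ℕ}
    (h₁ : p₁ ∈ POS) (h₂ : p₂ ∈ POS) (hd₁ : p₁.natDegree ≤ ℓ) (hd₂ : p₂.natDegree ≤ ℓ)
    (hneg : (T p₁).eval y < 0) (hpos : 0 < (T p₂).eval y) :
    ∃ p ∈ POS, p.natDegree ≤ ℓ ∧ (T p).eval y = 0 := by
  refine ⟨(T p₂).eval y • p₁ + (-(T p₁).eval y) • p₂, fun x => ?_, ?_, ?_⟩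
  · have := mul_pos hpos (h₁ x)
    have := mul_pos (neg_pos.mpr hneg) (h₂ x)
    simp only [eval_add, eval_smul, smul_eq_mul]
    linarith
  · exact natDegree_add_le_of_degree_le ((natDegree_smul_le _ _).trans hd₁)
      ((natDegree_smul_le _ _).trans hd₂)
  · simp only [map_add, map_smul, eval_add, eval_smul, smul_eq_mul]
    ring

theorem POS_subset_ELL : POS ⊆ ELL := fun _ hp x => (hp x).ne'

/-! ### Haviland's theorem by Riesz extension and Riesz–Markov–Kakutani -/

section Haviland

open Filter Topology

/-- The real functions on the line that are dominated by a polynomial. -/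
def polyBounded : Submodule ℝ (ℝ → ℝ) where
  carrier := {f | ∃ p : ℝ[X], ∀ x, |f x| ≤ p.eval x}
  zero_mem' := ⟨0, by simp⟩
  add_mem' := by
    rintro f g ⟨p, hp⟩ ⟨q, hq⟩
    refine ⟨p + q, fun x => ?_⟩
    rw [eval_add]
    exact (abs_add_le _ _).trans (add_le_add (hp x) (hq x))
  smul_mem' := by
    rintro c f ⟨p, hp⟩
    refine ⟨C |c| * p, fun x => ?_⟩
    rw [eval_mul, eval_C, Pi.smul_apply, smul_eq_mul, abs_mul]
    exact mul_le_mul_of_nonneg_left (hp x) (abs_nonneg c)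

theorem abs_eval_le_eval_one_add_sq (p : ℝ[X]) (x : ℝ) : |p.eval x| ≤ (1 + p ^ 2).eval x := by
  simp only [eval_add, eval_one, eval_pow]
  rw [abs_le]
  constructor <;> nlinarith [sq_nonneg (p.eval x + 1), sq_nonneg (p.eval x - 1)]

/-- The evaluation of polynomials, as a map into the functions dominated by a polynomial. -/
noncomputable def polyToBounded : ℝ[X] →ₗ[ℝ] polyBounded where
  toFun p := ⟨fun x => p.eval x, 1 + p ^ 2, abs_eval_le_eval_one_add_sq p⟩
  map_add' p q := by ext x; simp
  map_smul' c p := by ext x; simp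

theorem polyToBounded_injective : Function.Injective polyToBounded := fun _ _ h =>
  Polynomial.funext fun x => congrFun (congrArg Subtype.val h) x

/-- A functional on polynomials that is non-negative on the non-negative polynomials extends to a
positive functional on the functions dominated by a polynomial. -/
theorem exists_positive_extension (L : ℝ[X] →ₗ[ℝ] ℝ)
    (hL : ∀ p : ℝ[X], (∀ x, 0 ≤ p.eval x) → 0 ≤ L p) :
    ∃ g : polyBounded →ₗ[ℝ] ℝ, (∀ p, g (polyToBounded p) = L p) ∧
      ∀ f : polyBounded, (∀ x, 0 ≤ f.1 x) → 0 ≤ g f := by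
  let e := LinearEquiv.ofInjective polyToBounded polyToBounded_injective
  let s : PointedCone ℝ polyBounded :=
    { carrier := {f | ∀ x, 0 ≤ f.1 x}
      zero_mem' := fun x => le_rfl
      add_mem' := fun hf hg x => add_nonneg (hf x) (hg x)
      smul_mem' := fun c _ hf x => mul_nonneg c.2 (hf x) }
  let f₀ : polyBounded →ₗ.[ℝ] ℝ := ⟨LinearMap.range polyToBounded, L.comp e.symm.toLinearMap⟩
  have hnonneg : ∀ x : f₀.domain, (x : polyBounded) ∈ s → 0 ≤ f₀ x := by
    rintro ⟨_, p, rfl⟩ hp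
    change 0 ≤ L (e.symm (e p))
    rw [e.symm_apply_apply]
    exact hL p hp
  -- Polynomial domination is exactly what the Riesz extension theorem needs here.
  have hdense : ∀ y, ∃ x : f₀.domain, (x : polyBounded) + y ∈ s := by
    rintro ⟨f, p, hp⟩
    refine ⟨⟨polyToBounded p, p, rfl⟩, fun x => ?_⟩
    change 0 ≤ p.eval x + f x
    linarith [neg_abs_le (f x), hp x]
  obtain ⟨g, hg, hgs⟩ := riesz_extension s f₀ hnonneg hdense
  refine ⟨g, fun p => ?_, hgs⟩
  have := hg (e p)
  change g (polyToBounded p) = L (e.symm (e p)) at this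
  rwa [e.symm_apply_apply] at this

/-- A continuous cut-off function, equal to `1` on `[-n, n]` and to `0` off `(-n-1, n+1)`. -/
noncomputable def cutoff (n : ℕ) (x : ℝ) : ℝ := max 0 (min 1 (n + 1 - |x|))

theorem continuous_cutoff (n : ℕ) : Continuous (cutoff n) := by
  unfold cutoff; fun_prop

theorem cutoff_nonneg (n : ℕ) (x : ℝ) : 0 ≤ cutoff n x := le_max_left _ _

theorem cutoff_le_one (n : ℕ) (x : ℝ) : cutoff n x ≤ 1 :=
  max_le zero_le_one (min_le_left _ _)

theorem cutoff_eq_one {n : ℕ} {x : ℝ} (h : |x| ≤ n) : cutoff n x = 1 := by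
  rw [cutoff, min_eq_left (by linarith), max_eq_right zero_le_one]

theorem hasCompactSupport_cutoff (n : ℕ) : HasCompactSupport (cutoff n) := by
  refine HasCompactSupport.of_support_subset_isCompact (K := Set.Icc (-(n + 1 : ℝ)) (n + 1))
    isCompact_Icc fun x hx => ?_
  by_contra h
  refine hx (max_eq_left ((min_le_right _ _).trans ?_))
  have : ¬ |x| ≤ n + 1 := fun h' => h (abs_le.1 h')
  linarith

theorem one_sub_cutoff_mul_sq_le (n : ℕ) (x : ℝ) : (1 - cutoff n x) * n ^ 2 ≤ x ^ 2 := by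
  by_cases h : |x| ≤ n
  · rw [cutoff_eq_one h]; nlinarith [sq_nonneg x]
  · push Not at h
    have h1 : (n : ℝ) ^ 2 ≤ x ^ 2 := by
      rw [← sq_abs x]; exact pow_le_pow_left₀ (Nat.cast_nonneg n) h.le 2
    nlinarith [cutoff_nonneg n x, sq_nonneg (n : ℝ)]

theorem tendsto_cutoff (x : ℝ) : Tendsto (fun n => cutoff n x) atTop (𝓝 1) := by
  refine tendsto_const_nhds.congr' ?_
  filter_upwards [eventually_ge_atTop ⌈|x|⌉₊] with n hn
  exact (cutoff_eq_one (Nat.ceil_le.mp hn)).symm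

/-- The product of a polynomial with a cut-off function. -/
noncomputable def cutPoly (n : ℕ) (p : ℝ[X]) : CompactlySupportedContinuousMap ℝ ℝ where
  toFun x := cutoff n x * p.eval x
  continuous_toFun := (continuous_cutoff n).mul p.continuous
  hasCompactSupport' := (hasCompactSupport_cutoff n).mul_right

/-- Compactly supported continuous functions are dominated by a polynomial. -/
noncomputable def compactlySupportedToBounded :
    CompactlySupportedContinuousMap ℝ ℝ →ₗ[ℝ] polyBounded where
  toFun f := ⟨f, by
    obtain ⟨c, hc⟩ := f.hasCompactSupport.exists_bound_of_continuous f.continuous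
    exact ⟨C c, fun x => by rw [eval_C]; exact hc x⟩⟩
  map_add' f g := rfl
  map_smul' c f := rfl

/-- **Haviland's theorem** on the real line. -/
theorem exists_measure_of_nonneg (L : ℝ[X] →ₗ[ℝ] ℝ)
    (hL : ∀ p : ℝ[X], (∀ x, 0 ≤ p.eval x) → 0 ≤ L p) :
    ∃ μ : Measure ℝ, ∀ p : ℝ[X], Integrable (fun t => p.eval t) μ ∧ L p = ∫ t, p.eval t ∂μ := by
  obtain ⟨g, hgL, hg⟩ := exists_positive_extension L hL
  have hmono : ∀ f₁ f₂ : polyBounded, (∀ x, f₁.1 x ≤ f₂.1 x) → g f₁ ≤ g f₂ := by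
    intro f₁ f₂ h
    rw [← sub_nonneg, ← map_sub]
    exact hg _ fun x => sub_nonneg.2 (h x)
  let Λ : CompactlySupportedContinuousMap ℝ ℝ →ₚ[ℝ] ℝ :=
    PositiveLinearMap.mk₀ (g.comp compactlySupportedToBounded) fun f hf => hg _ hf
  let μ := RealRMK.rieszMeasure Λ
  have hΛ : ∀ f, ∫ x, f x ∂μ = g (compactlySupportedToBounded f) :=
    RealRMK.integral_rieszMeasure Λ
  have hint0 : ∀ p : ℝ[X], (∀ x, 0 ≤ p.eval x) → Integrable (fun t => p.eval t) μ := by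
    intro p hp
    have hcov : AECover μ atTop fun n : ℕ => Set.Icc (-(n : ℝ)) n :=
      aecover_Icc (tendsto_neg_atTop_atBot.comp tendsto_natCast_atTop_atTop)
        tendsto_natCast_atTop_atTop
    -- Truncations of `p ≥ 0` lie below `p`, so `L p` bounds all the integrals over `[-n, n]`.
    refine hcov.integrable_of_integral_bounded_of_nonneg_ae (L p)
      (fun n => p.continuous.continuousOn.integrableOn_compact isCompact_Icc)
      (Eventually.of_forall hp) (Eventually.of_forall fun n => ?_)
    calc ∫ x in Set.Icc (-(n : ℝ)) n, p.eval x ∂μ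
        = ∫ x in Set.Icc (-(n : ℝ)) n, cutPoly n p x ∂μ := by
          refine setIntegral_congr_fun measurableSet_Icc fun x hx => ?_
          change _ = cutoff n x * p.eval x
          rw [cutoff_eq_one (abs_le.2 hx), one_mul]
      _ ≤ ∫ x, cutPoly n p x ∂μ :=
          setIntegral_le_integral (cutPoly n p).integrable
            (Eventually.of_forall fun x => mul_nonneg (cutoff_nonneg n x) (hp x))
      _ ≤ L p := by
          rw [hΛ, ← hgL]
          exact hmono _ _ fun x => mul_le_of_le_one_left (hp x) (cutoff_le_one n x)
  have hint : ∀ p : ℝ[X], Integrable (fun t => p.eval t) μ := fun p =>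
    (hint0 (1 + p ^ 2) fun x => (abs_nonneg _).trans (abs_eval_le_eval_one_add_sq p x)).mono'
      p.continuous.aestronglyMeasurable
      (Eventually.of_forall fun x => abs_eval_le_eval_one_add_sq p x)
  refine ⟨μ, fun p => ⟨hint p, ?_⟩⟩
  have h1 : Tendsto (fun n => g (compactlySupportedToBounded (cutPoly n p))) atTop
      (𝓝 (∫ t, p.eval t ∂μ)) := by
    simp_rw [← hΛ]
    refine tendsto_integral_of_dominated_convergence (fun t => |p.eval t|)
      (fun n => (cutPoly n p).continuous.aestronglyMeasurable) (hint p).abs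
      (fun n => Eventually.of_forall fun x => ?_) (Eventually.of_forall fun x => ?_)
    · change |cutoff n x * p.eval x| ≤ _
      rw [abs_mul, abs_of_nonneg (cutoff_nonneg n x)]
      exact mul_le_of_le_one_left (abs_nonneg _) (cutoff_le_one n x)
    · change Tendsto (fun n => cutoff n x * p.eval x) _ _
      simpa using (tendsto_cutoff x).mul_const (p.eval x)
  refine tendsto_nhds_unique ?_ h1
  -- The truncated values also tend to `L p`: the truncation error is at most `x²(1 + p²)/n²`
  -- pointwise, and `g` is monotone.
  have h2 : Tendsto (fun n : ℕ => L (X ^ 2 * (1 + p ^ 2)) * ((n : ℝ) ^ 2)⁻¹) atTop (𝓝 0) := by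
    have : Tendsto (fun n : ℕ => ((n : ℝ) ^ 2)⁻¹) atTop (𝓝 0) :=
      ((tendsto_pow_atTop two_ne_zero).comp tendsto_natCast_atTop_atTop).inv_tendsto_atTop
    simpa using this.const_mul (L (X ^ 2 * (1 + p ^ 2)))
  rw [tendsto_iff_norm_sub_tendsto_zero]
  refine squeeze_zero' (Eventually.of_forall fun n => norm_nonneg _) ?_ h2
  filter_upwards [eventually_gt_atTop 0] with n hn
  have hn2 : (0 : ℝ) < (n : ℝ) ^ 2 := by positivity
  have key : ∀ x, (1 - cutoff n x) * |p.eval x| ≤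
      ((n : ℝ) ^ 2)⁻¹ * (X ^ 2 * (1 + p ^ 2)).eval x := by
    intro x
    have h3 := mul_le_mul (one_sub_cutoff_mul_sq_le n x) (abs_eval_le_eval_one_add_sq p x)
      (abs_nonneg _) (sq_nonneg x)
    rw [inv_mul_eq_div, le_div_iff₀ hn2, eval_mul, eval_pow, eval_X]
    linarith
  rw [← hgL p, ← map_sub, mul_comm, ← hgL, ← smul_eq_mul, ← map_smul, Real.norm_eq_abs, abs_le,
    ← map_neg]
  have hx1 : ∀ x, 0 ≤ 1 - cutoff n x := fun x => sub_nonneg.2 (cutoff_le_one n x)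
  constructor <;> refine hmono _ _ fun x => ?_
  · change -(((n : ℝ) ^ 2)⁻¹ * (X ^ 2 * (1 + p ^ 2)).eval x) ≤ cutoff n x * p.eval x - p.eval x
    have := mul_le_mul_of_nonneg_left (le_abs_self (p.eval x)) (hx1 x)
    linarith [key x]
  · change cutoff n x * p.eval x - p.eval x ≤ ((n : ℝ) ^ 2)⁻¹ * (X ^ 2 * (1 + p ^ 2)).eval x
    have := mul_le_mul_of_nonneg_left (neg_abs_le (p.eval x)) (hx1 x)
    linarith [key x]

end Haviland

/-! ### Constant coefficients and moment convolutions -/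

theorem IsConstCoeff.map_taylor {T : ℝ[X] →ₗ[ℝ] ℝ[X]} (hT : IsConstCoeff T) (x : ℝ) (f : ℝ[X]) :
    T (taylor x f) = taylor x (T f) := by
  obtain ⟨a, ha⟩ := hT
  have hder : Function.Commute (taylor x) (derivative : ℝ[X] →ₗ[ℝ] ℝ[X]) := by
    intro g
    simp [taylor_apply, derivative_comp]
  rw [ha, ha, natDegree_taylor, map_sum]
  refine Finset.sum_congr rfl fun i _ => ?_
  rw [taylor_mul, taylor_C, (hder.iterate_right i).eq f]

theorem IsConstCoeff.eval_map {T : ℝ[X] →ₗ[ℝ] ℝ[X]} (hT : IsConstCoeff T) (x : ℝ) (f : ℝ[X]) :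
    (T f).eval x = (T (taylor x f)).eval 0 := by
  rw [hT.map_taylor, taylor_eval, zero_add]

theorem IsConstCoeff.isMomentConvolution {T : ℝ[X] →ₗ[ℝ] ℝ[X]} (hT : IsConstCoeff T)
    (h : ∀ p : ℝ[X], (∀ x, 0 ≤ p.eval x) → 0 ≤ (T p).eval 0) : IsMomentConvolution T := by
  obtain ⟨μ, hμ⟩ := exists_measure_of_nonneg ((leval 0).comp T) h
  refine ⟨μ, fun m => by simpa using (hμ (X ^ m)).1, fun f x => ?_⟩
  rw [hT.eval_map]
  refine (hμ (taylor x f)).2.trans ?_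
  simp_rw [taylor_eval]

theorem eval_nonneg_of_preserves_POS {T : ℝ[X] →ₗ[ℝ] ℝ[X]} (hT : T ∈ preservers POS) {p : ℝ[X]}
    (hp : ∀ x, 0 ≤ p.eval x) (y : ℝ) : 0 ≤ (T p).eval y := by
  have hpos : ∀ ε : ℝ, 0 < ε → 0 < (T p).eval y + ε * (T 1).eval y := by
    intro ε hε
    have : p + ε • (1 : ℝ[X]) ∈ POS := fun x => by
      simp only [eval_add, eval_smul, eval_one, smul_eq_mul]
      linarith [hp x]
    simpa using hT ⟨_, this, rfl⟩ y
  by_contra! hneg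
  have h1 : 0 < (T 1).eval y := hT ⟨1, fun x => by simp, rfl⟩ y
  -- This `ε` makes the perturbed value exactly zero.
  have := hpos (-(T p).eval y / (T 1).eval y) (div_pos (by linarith) h1)
  rw [div_mul_cancel₀ _ h1.ne'] at this
  linarith

theorem IsMomentConvolution.mem_preservers_SOS {T : ℝ[X] →ₗ[ℝ] ℝ[X]} (hT : IsMomentConvolution T) :
    T ∈ preservers SOS := by
  obtain ⟨μ, -, hμ⟩ := hT
  rintro _ ⟨p, hp, rfl⟩
  refine mem_SOS_iff.2 fun x => ?_
  rw [hμ]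
  exact integral_nonneg fun t => mem_SOS_iff.1 hp _

theorem HasFiniteMoments.integrable_eval {μ : Measure ℝ} (hμ : HasFiniteMoments μ) (p : ℝ[X]) :
    Integrable (fun t => p.eval t) μ := by
  simp_rw [eval_eq_sum_range]
  exact integrable_finsetSum _ fun i _ => (hμ i).const_mul _

theorem IsMomentConvolution.mem_preservers_POS {T : ℝ[X] →ₗ[ℝ] ℝ[X]} (hT : IsMomentConvolution T)
    (hT0 : T ≠ 0) : T ∈ preservers POS := by
  obtain ⟨μ, hm, hμ⟩ := hT
  have hμ0 : μ ≠ 0 := by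
    rintro rfl
    exact hT0 (LinearMap.ext fun f => Polynomial.funext fun x => by simp [hμ])
  rintro _ ⟨p, hp, rfl⟩ x
  rw [hμ]
  have hint : Integrable (fun t => p.eval (t + x)) μ := by
    simpa only [taylor_eval] using hm.integrable_eval (taylor x p)
  rw [integral_pos_iff_support_of_nonneg (fun t => (hp _).le) hint]
  have : Function.support (fun t => p.eval (t + x)) = Set.univ :=
    Set.eq_univ_of_forall fun t => (hp _).ne'
  rw [this, pos_iff_ne_zero]
  simpa using hμ0

/-! ### Elliptic polynomials and the final assembly -/

theorem mem_POS_or_neg_mem_POS {p : ℝ[X]} (hp : p ∈ ELL) : p ∈ POS ∨ -p ∈ POS := by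
  by_contra! h
  obtain ⟨h1, h2⟩ := h
  simp only [POS, Set.mem_ofPred_eq, not_forall, not_lt, eval_neg, Left.neg_pos_iff] at h1 h2
  obtain ⟨⟨x, hx⟩, y, hy⟩ := h1, h2
  obtain ⟨z, hz⟩ := mem_range_of_exists_le_of_exists_ge p.continuous ⟨x, hx⟩ ⟨y, hy⟩
  exact hp z hz

theorem neg_mem_ELL {p : ℝ[X]} (hp : -p ∈ ELL) : p ∈ ELL := fun x => by
  simpa using hp x

theorem mem_preservers_ELL_of_POS {T : ℝ[X] →ₗ[ℝ] ℝ[X]} (hT : T ∈ preservers POS) :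
    T ∈ preservers ELL := by
  rintro _ ⟨p, hp, rfl⟩
  rcases mem_POS_or_neg_mem_POS hp with h | h
  · exact POS_subset_ELL (hT ⟨p, h, rfl⟩)
  · refine neg_mem_ELL (POS_subset_ELL ?_)
    rw [← map_neg]
    exact hT ⟨_, h, rfl⟩

/-- Elliptic polynomials have constant sign. If `T` sent two positive polynomials to opposite signs,
a positive combination would have an image vanishing at `0`. -/
theorem mem_preservers_ELL_iff {T : ℝ[X] →ₗ[ℝ] ℝ[X]} :
    T ∈ preservers ELL ↔ T ∈ preservers POS ∨ -T ∈ preservers POS := by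
  constructor
  · intro hT
    by_contra! h
    simp only [preservers, Set.mem_ofPred_eq, Set.image_subset_iff, Set.not_subset] at h
    obtain ⟨⟨p, hp, hTp⟩, q, hq, hTq⟩ := h
    have hTp' : -(T p) ∈ POS := (mem_POS_or_neg_mem_POS (hT ⟨p, POS_subset_ELL hp, rfl⟩)).resolve_left hTp
    have hTq' : T q ∈ POS := (mem_POS_or_neg_mem_POS (hT ⟨q, POS_subset_ELL hq, rfl⟩)).resolve_right hTq
    obtain ⟨r, hr, -, hr0⟩ := exists_mem_POS_eval_eq_zero (y := 0) hp hq
      (le_max_left p.natDegree q.natDegree) (le_max_right _ _)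
      (by simpa using hTp' 0) (hTq' 0)
    exact hT ⟨r, POS_subset_ELL hr, rfl⟩ 0 hr0
  · rintro (h | h)
    · exact mem_preservers_ELL_of_POS h
    · rintro _ ⟨p, hp, rfl⟩
      exact neg_mem_ELL (mem_preservers_ELL_of_POS h ⟨p, hp, rfl⟩)

theorem IsWeylOfOrder.image_degreePart_diff_nonempty {T : ℝ[X] →ₗ[ℝ] ℝ[X]} {d : ℕ} (hd : 1 ≤ d)
    (hT : IsWeylOfOrder T d) {ℓ : ℕ} (hℓ : Even ℓ) (hdℓ : d < ℓ) {V : Set ℝ[X]}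
    (hV : V ∈ ({POS, SOS, ELL} : Set (Set ℝ[X]))) : ((T '' degreePart V ℓ) \ V).Nonempty := by
  obtain ⟨y, p₁, p₂, h₁, h₂, hs₁, hd₁, hd₂, hneg, hpos⟩ := hT.exists_eval_pos_and_neg hd hℓ hdℓ
  rcases hV with rfl | rfl | rfl
  · exact ⟨T p₁, ⟨p₁, ⟨h₁, hd₁⟩, rfl⟩, fun h => (h y).not_gt hneg⟩
  · exact ⟨T p₁, ⟨p₁, ⟨hs₁, hd₁⟩, rfl⟩, fun h => (mem_SOS_iff.1 h y).not_gt hneg⟩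
  · obtain ⟨p, hp, hpd, hp0⟩ := exists_mem_POS_eval_eq_zero h₁ h₂ hd₁ hd₂ hneg hpos
    exact ⟨T p, ⟨p, ⟨POS_subset_ELL hp, hpd⟩, rfl⟩, fun h => h y hp0⟩

theorem IsWeylOfOrder.notMem_preservers {T : ℝ[X] →ₗ[ℝ] ℝ[X]} {d : ℕ} (hd : 1 ≤ d)
    (hT : IsWeylOfOrder T d) {V : Set ℝ[X]} (hV : V ∈ ({POS, SOS, ELL} : Set (Set ℝ[X]))) :
    T ∉ preservers V := by
  intro h
  obtain ⟨_, ⟨p, ⟨hp, -⟩, rfl⟩, hn⟩ :=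
    hT.image_degreePart_diff_nonempty hd (ℓ := 2 * d) (even_two_mul d) (by omega) hV
  exact hn (h ⟨p, hp, rfl⟩)

theorem corollary4p1 :
    (∀ (T : ℝ[X] →ₗ[ℝ] ℝ[X]) (d : ℕ), 1 ≤ d → IsWeylOfOrder T d →
      ∀ ℓ : ℕ, Even ℓ → d < ℓ → ∀ V ∈ ({POS, SOS, ELL} : Set (Set ℝ[X])),
        ((T '' degreePart V ℓ) \ V).Nonempty) ∧
    (∀ (T : ℝ[X] →ₗ[ℝ] ℝ[X]) (d : ℕ), 1 ≤ d → IsWeylOfOrder T d →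
      T ∉ preservers POS ∪ preservers SOS ∪ preservers ELL) ∧
    (∀ T : ℝ[X] →ₗ[ℝ] ℝ[X], T ≠ 0 → IsConstCoeff T →
      (T ∈ preservers POS ↔ T ∈ preservers SOS) ∧
      (T ∈ preservers SOS ↔ IsMomentConvolution T) ∧
      (T ∈ preservers ELL ↔ T ∈ preservers POS ∨ -T ∈ preservers POS)) := by
  refine ⟨fun T d hd hT ℓ hℓ hdℓ V hV => hT.image_degreePart_diff_nonempty hd hℓ hdℓ hV,
    fun T d hd hT => ?_, fun T hT0 hT => ?_⟩
  · rintro ((h | h) | h)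
    · exact hT.notMem_preservers hd (by simp) h
    · exact hT.notMem_preservers hd (by simp) h
    · exact hT.notMem_preservers hd (by simp) h
  · have hSOS : T ∈ preservers SOS ↔ IsMomentConvolution T :=
      ⟨fun h => hT.isMomentConvolution fun p hp =>
        mem_SOS_iff.1 (h ⟨p, mem_SOS_iff.2 hp, rfl⟩) 0, fun h => h.mem_preservers_SOS⟩
    refine ⟨?_, hSOS, mem_preservers_ELL_iff⟩
    rw [hSOS]
    exact ⟨fun h => hT.isMomentConvolution fun p hp => eval_nonneg_of_preserves_POS h hp 0,
      fun h => h.mem_preservers_POS hT0⟩
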